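/- There is an absolute constant $K>0$ such that the following holds for every finite simple graph $G$ with $n\ge 1$ vertices. For a set $E'\subseteq E(G)$, a $(d,c)$ cycle cover for $E'$ is a collection $\mathcal C$ of simple cycles of $G$, each of length at most $d$, such that every edge of $E'$ lies on at least one cycle of $\mathcal C$ and every edge of $G$ lies on at most $c$ cycles of $\mathcal C$. A graph is bridgeless if it is connected and remains connected after the removal of any single edge. The depth of a rooted tree is the largest distance from its root to a vertex. (1) If $G$ is bridgeless and $T\subseteq G$ is a rooted spanning tree of depth $D$, then there is a $(K\,D\log n,\;K\log^3 n)$ cycle cover for $E(T)$. (2) More generally, if $G$ is connected (not necessarily bridgeless) and $T\subseteq G$ is a rooted spanning tree of depth $D$, then there is a $(K\,D\log n,\;K\log^3 n)$ cycle cover for the set of all edges of $T$ that lie on some cycle of $G$. (3) Consequently, if $G$ is connected with diameter $D$, then there is a $(K\,D\log n,\;K\log^3 n)$ cycle cover for the set of all edges of $G$ that lie on some cycle of $G$ (the construction is "nice": it needs no bridgelessness and covers every edge that lies on a cycle). -/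

import Mathlib

/-- `G` is bridgeless: it is connected and the removal of any single edge keeps it connected. -/
def Bridgeless {V : Type*} (G : SimpleGraph V) : Prop :=
  G.Connected ∧ ∀ e ∈ G.edgeSet, (G.deleteEdges {e}).Connected

/-- `C` is the edge set of a simple cycle of `G`; the length of that cycle is then `C.card`. -/
def IsCycleOf {V : Type*} [DecidableEq V] (G : SimpleGraph V) (C : Finset (Sym2 V)) : Prop :=
  ∃ (v : V) (p : G.Walk v v), p.IsCycle ∧ p.edges.toFinset = C

/-- The edges of `G` that lie on some cycle of `G`. -/
def cycleEdges {V : Type*} [DecidableEq V] (G : SimpleGraph V) : Set (Sym2 V) :=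
  {e | ∃ C : Finset (Sym2 V), IsCycleOf G C ∧ e ∈ C}

/-- `𝒞` is a `(d, c)` cycle cover for the set `E'` of edges of `G`: a collection of cycles of `G`
of length at most `d`, such that each edge of `E'` is on at least one of them and each edge of
the whole graph `G` is on at most `c` of them. -/
structure IsCycleCover {V : Type*} [DecidableEq V] (G : SimpleGraph V) (E' : Set (Sym2 V))
    (d c : ℝ) (𝒞 : Finset (Finset (Sym2 V))) : Prop where
  isCycle : ∀ C ∈ 𝒞, IsCycleOf G C
  dilation : ∀ C ∈ 𝒞, (C.card : ℝ) ≤ d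
  covers : ∀ e ∈ E', ∃ C ∈ 𝒞, e ∈ C
  congestion : ∀ e ∈ G.edgeSet, ((𝒞.filter (fun C => e ∈ C)).card : ℝ) ≤ c

/-- The depth of the tree `T` rooted at `r`: the largest distance in `T` from `r` to a vertex. -/
noncomputable def treeDepth {V : Type*} [Fintype V] (T : SimpleGraph V) (r : V) : ℕ :=
  Finset.univ.sup (fun v => T.dist r v)

/-! All three parts reduce to one statement: for a spanning tree `T` of depth `D`, the edges of `G`
lying on cycles can be covered with length O(D log n) and congestion O(log² n). In a bridgeless
graph every edge lies on a cycle, and for part (3) a breadth-first tree has depth at most the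
diameter. Work over `ZMod 2`. Each non-tree edge closes a fundamental cycle, and every edge on a
cycle of `G` lies on one of these. A uniformly random set of non-tree edges has a fundamental-cycle
sum containing a given such edge with probability 1/2, so O(log n) sets suffice to catch all of them
(`exists_family_sum_eq_one`). Each chosen set is cut into pieces of O(log n) edges. A piece's cycle
sum has O(D log n) edges and even degrees, hence splits into edge-disjoint simple cycles. A covered
edge has odd total over the whole set, so it survives in some piece. The pieces must overlap little.
A tree edge `e` is in the sum of a piece iff an odd number of the piece's endpoints lie below `e`,
and the vertices below `e` form an interval in a depth-first order. It therefore suffices that few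
pieces have odd parity on any lower set (`exists_partition_crossParity_le`). Cut the ordered
endpoints into blocks of 16 and regard blocks as vertices of a multigraph. Its average degree is
high enough that short even sets can be removed until at most a constant fraction of the edges is
left (`exists_short_isEvenEdgeSet`). A lower set splits at most one block, so only the at most 16
disjoint even sets touching that block can be odd. Recursion on the leftover has logarithmic depth.
-/

/-! ### Even edge sets and simple cycles -/

-- A longest trail must be closed: at an end different from the other end it uses an odd number of
-- edges, so evenness leaves an unused edge that would extend it. A nontrivial closed trail contains
-- a cycle.
open Finset in
theorem exists_isCycle_of_even {V : Type*} [Fintype V] [DecidableEq V] (Z : Finset (Sym2 V))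
    (hdiag : ∀ e ∈ Z, ¬ e.IsDiag) (heven : ∀ x, Even #{e ∈ Z | x ∈ e}) (hne : Z.Nonempty) :
    ∃ (v : V) (p : (SimpleGraph.fromEdgeSet (Z : Set (Sym2 V))).Walk v v), p.IsCycle := by
  classical
  set H := SimpleGraph.fromEdgeSet (Z : Set (Sym2 V)) with hH
  have hadj : ∀ x y, H.Adj x y ↔ s(x, y) ∈ Z := by
    intro x y
    rw [hH, SimpleGraph.fromEdgeSet_adj]
    refine ⟨fun h => by simpa using h.1, fun h => ⟨by simpa using h, fun hxy => ?_⟩⟩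
    exact hdiag _ h (by simp [hxy])
  have hedge : ∀ e, e ∈ H.edgeSet ↔ e ∈ Z := by
    intro e
    induction e with | _ x y => exact hadj x y
  obtain ⟨e, he⟩ := hne
  induction e with | _ x y =>
  have : Nonempty V := ⟨x⟩
  obtain ⟨u, v, p, hp, hmax⟩ := SimpleGraph.Walk.exists_isTrail_forall_isTrail_length_le_length H
  have hlen : 1 ≤ p.length :=
    hmax x y (SimpleGraph.Walk.cons ((hadj x y).2 he) .nil) (by simp)
  have huv : u = v := by
    by_contra hne
    have hodd : ¬ Even (p.edges.countP fun e => u ∈ e) := by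
      rw [hp.even_countP_edges_iff u]
      simp [hne]
    have hcount : #{e ∈ p.edges.toFinset | u ∈ e} = p.edges.countP fun e => u ∈ e := by
      rw [List.countP_eq_length_filter, ← List.toFinset_card_of_nodup (hp.edges_nodup.filter _)]
      congr 1
      ext e
      simp
    have hsub : ({e ∈ p.edges.toFinset | u ∈ e} : Finset _) ⊆ {e ∈ Z | u ∈ e} := by
      intro e
      simp only [mem_filter, List.mem_toFinset]
      exact fun h => ⟨(hedge e).1 (p.edges_subset_edgeSet h.1), h.2⟩
    have hss : ({e ∈ p.edges.toFinset | u ∈ e} : Finset _) ≠ {e ∈ Z | u ∈ e} := by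
      intro h
      rw [← hcount, h] at hodd
      exact hodd (heven u)
    obtain ⟨e, he, hep⟩ := Finset.exists_of_ssubset (hsub.ssubset_of_ne hss)
    simp only [mem_filter, List.mem_toFinset, not_and] at he hep
    obtain ⟨w, rfl⟩ := Sym2.mem_iff_exists.1 he.2
    have hw : H.Adj w u := ((hadj u w).2 he.1).symm
    have := hmax w v (SimpleGraph.Walk.cons hw p) (by
      rw [SimpleGraph.Walk.isTrail_cons]
      exact ⟨hp, fun h => hep (by rwa [Sym2.eq_swap] at h) he.2⟩)
    simp at this
  subst huv
  exact ⟨u, p.cycleBypass, hp.isCycle_cycleBypass (by rintro rfl; simp at hlen)⟩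

open Finset in
theorem IsCycleOf.even_card_filter {V : Type*} [DecidableEq V] {G : SimpleGraph V}
    {C : Finset (Sym2 V)} (hC : IsCycleOf G C) (x : V) : Even #{e ∈ C | x ∈ e} := by
  classical
  obtain ⟨v, p, hp, rfl⟩ := hC
  have h := (hp.isTrail.even_countP_edges_iff x).2 (by simp)
  rw [List.countP_eq_length_filter,
    ← List.toFinset_card_of_nodup (hp.isTrail.edges_nodup.filter _)] at h
  convert h using 2
  ext e
  simp

theorem IsCycleOf.nonempty {V : Type*} [DecidableEq V] {G : SimpleGraph V}
    {C : Finset (Sym2 V)} (hC : IsCycleOf G C) : C.Nonempty := by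
  obtain ⟨v, p, hp, rfl⟩ := hC
  rw [List.toFinset_nonempty_iff]
  intro h
  have := hp.three_le_length
  rw [← SimpleGraph.Walk.length_edges, h] at this
  simp at this

open Finset in
/-- A set of edges with all degrees even is an edge-disjoint union of simple cycles. -/
theorem exists_disjoint_cycles_of_even {V : Type*} [Fintype V] [DecidableEq V]
    (G : SimpleGraph V) (Z : Finset (Sym2 V)) (hZ : ∀ e ∈ Z, e ∈ G.edgeSet)
    (heven : ∀ x, Even #{e ∈ Z | x ∈ e}) :
    ∃ 𝒞 : Finset (Finset (Sym2 V)), (∀ C ∈ 𝒞, IsCycleOf G C) ∧ (∀ C ∈ 𝒞, C ⊆ Z) ∧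
      (∀ e ∈ Z, ∃ C ∈ 𝒞, e ∈ C) ∧ ∀ e, #{C ∈ 𝒞 | e ∈ C} ≤ 1 := by
  induction hn : #Z using Nat.strong_induction_on generalizing Z with | _ n ih =>
  subst hn
  rcases Z.eq_empty_or_nonempty with rfl | hne
  · exact ⟨∅, by simp⟩
  obtain ⟨v, p, hp⟩ := exists_isCycle_of_even Z
    (fun e he => G.not_isDiag_of_mem_edgeSet (hZ e he)) heven hne
  have hpZ : ∀ e ∈ p.edges, e ∈ Z := fun e he => by
    have := p.edges_subset_edgeSet he
    rw [SimpleGraph.edgeSet_fromEdgeSet] at this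
    exact this.1
  have hle : SimpleGraph.fromEdgeSet (Z : Set (Sym2 V)) ≤ G := by
    intro x y h
    rw [SimpleGraph.fromEdgeSet_adj] at h
    exact hZ _ (by simpa using h.1)
  set C := p.edges.toFinset with hCdef
  have hC : IsCycleOf G C :=
    ⟨v, p.mapLe hle, (SimpleGraph.Walk.isCycle_mapLe hle).2 hp, by simp [hCdef]⟩
  have hCZ : C ⊆ Z := fun e he => hpZ e (by simpa [hCdef] using he)
  obtain ⟨𝒞, h1, h2, h3, h4⟩ := ih #(Z \ C)
    (card_lt_card (sdiff_ssubset hCZ hC.nonempty)) (Z \ C)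
    (fun e he => hZ e (mem_sdiff.1 he).1) (fun x => by
      have h := heven x
      have h' := hC.even_card_filter x
      have hs : #{e ∈ Z | x ∈ e} = #{e ∈ Z \ C | x ∈ e} + #{e ∈ C | x ∈ e} := by
        rw [← card_union_of_disjoint
          (disjoint_filter_filter sdiff_disjoint), ← filter_union, sdiff_union_of_subset hCZ]
      rw [hs, Nat.even_add] at h
      exact h.2 h') rfl
  refine ⟨insert C 𝒞, ?_, ?_, ?_, ?_⟩
  · simpa [hC] using h1
  · simp only [mem_insert, forall_eq_or_imp]
    exact ⟨hCZ, fun D hD => (h2 D hD).trans sdiff_subset⟩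
  · intro e he
    by_cases heC : e ∈ C
    · exact ⟨C, by simp, heC⟩
    · obtain ⟨D, hD, heD⟩ := h3 e (by simp [he, heC])
      exact ⟨D, by simp [hD], heD⟩
  · intro e
    rw [filter_insert]
    split_ifs with heC
    · have : ({D ∈ 𝒞 | e ∈ D} : Finset _) = ∅ := by
        refine filter_eq_empty_iff.2 fun D hD heD => ?_
        exact (mem_sdiff.1 (h2 D hD heD)).2 heC
      simp [this]
    · exact h4 e

/-! ### Short even sets in dense multigraphs -/

open Finset in
theorem sum_symmDiff_of_charTwo {α M : Type*} [DecidableEq α] [AddCommGroup M]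
    (hM : ∀ m : M, m + m = 0) (A B : Finset α) (g : α → M) :
    ∑ f ∈ symmDiff A B, g f = ∑ f ∈ A, g f + ∑ f ∈ B, g f := by
  have h1 : ∑ f ∈ symmDiff A B, g f = ∑ f ∈ A \ B, g f + ∑ f ∈ B \ A, g f := by
    rw [symmDiff_def, sup_eq_union, sum_union (by
      exact disjoint_sdiff_sdiff)]
  rw [h1, ← sum_inter_add_sum_sdiff A B g, ← sum_inter_add_sum_sdiff B A g, inter_comm B A]
  have := hM (∑ f ∈ A ∩ B, g f)
  calc _ = (∑ f ∈ A ∩ B, g f + ∑ f ∈ A ∩ B, g f)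
        + (∑ f ∈ A \ B, g f + ∑ f ∈ B \ A, g f) := by rw [this, zero_add]
    _ = _ := by abel

open Finset in
/-- `S` is an even set of edges of the multigraph in which `f` joins `x f` to `y f`. -/
def IsEvenEdgeSet {α β : Type*} (x y : α → β) (S : Finset α) : Prop :=
  ∀ g : β → ZMod 2, ∑ f ∈ S, (g (x f) + g (y f)) = 0

open Finset in
/-- If every `f ∈ E` is, modulo 2, the sum of two members of a family `P` of finite sets indexed
by `B`, one of which is empty, then `E` has fewer elements than `B`. -/
theorem card_lt_card_of_eq_symmDiff {α β : Type*} [DecidableEq α] [DecidableEq β]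
    (E : Finset α) (B : Finset β) (P : β → Finset α) (v : β) (hv : v ∈ B) (hP : P v = ∅)
    (x y : α → β) (hx : ∀ f ∈ E, x f ∈ B) (hy : ∀ f ∈ E, y f ∈ B)
    (hE : ∀ f ∈ E, {f} = symmDiff (P (x f)) (P (y f))) : #E < #B := by
  classical
  let χ : Finset α → α → ZMod 2 := fun S a => if a ∈ S then 1 else 0
  have hχ : ∀ A C : Finset α, χ (symmDiff A C) = χ A + χ C := by
    intro A C
    ext a
    by_cases h1 : a ∈ A <;> by_cases h2 : a ∈ C <;> simp [χ, mem_symmDiff, h1, h2]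
    decide
  have hli : LinearIndependent (ZMod 2) (fun f : E => (Pi.single (f : α) 1 : α → ZMod 2)) :=
    (Pi.linearIndependent_single_one α (ZMod 2)).comp _ Subtype.val_injective
  -- The vector at `v` is zero, so the span needs only the other members of `B`; this makes the
  -- inequality strict.
  let W : Finset (α → ZMod 2) := (B.erase v).image fun w => χ (P w)
  have hmem : ∀ w ∈ B, χ (P w) ∈ Submodule.span (ZMod 2) (W : Set (α → ZMod 2)) := by
    intro w hw
    by_cases hwv : w = v
    · subst hwv
      have : χ (P w) = 0 := by ext a; simp [χ, hP]
      rw [this]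
      exact zero_mem _
    · exact Submodule.subset_span (by
        simp only [W, coe_image, Set.mem_image, mem_coe, mem_erase]
        exact ⟨w, ⟨hwv, hw⟩, rfl⟩)
  have hspan : Set.range (fun f : E => (Pi.single (f : α) 1 : α → ZMod 2)) ≤
      Submodule.span (ZMod 2) (W : Set (α → ZMod 2)) := by
    rintro _ ⟨⟨f, hf⟩, rfl⟩
    have : (Pi.single f 1 : α → ZMod 2) = χ (P (x f)) + χ (P (y f)) := by
      rw [← hχ, ← hE f hf]
      ext a
      simp [χ, Pi.single_apply]
    show Pi.single f 1 ∈ Submodule.span (ZMod 2) (W : Set (α → ZMod 2))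
    rw [this]
    exact add_mem (hmem _ (hx f hf)) (hmem _ (hy f hf))
  have h := linearIndependent_le_span' _ hli (W : Set (α → ZMod 2)) hspan
  have h' : #E ≤ #W := by simpa using h
  calc #E ≤ #W := h'
    _ ≤ #(B.erase v) := card_image_le
    _ < #B := card_erase_lt_of_mem hv

open Finset in
/-- A multigraph with at least twice as many edges as vertices contains a nonempty even set
of logarithmic size. -/
theorem exists_short_isEvenEdgeSet {α β : Type*} [DecidableEq α] [DecidableEq β] (x y : α → β)
    (l : ℕ) (W : Finset β) (E : Finset α) (hE : ∀ f ∈ E, x f ∈ W ∧ y f ∈ W) (hW : #W ≤ 2 ^ l)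
    (hne : E.Nonempty) (hcard : 2 * #W ≤ #E) :
    ∃ S ⊆ E, S.Nonempty ∧ #S ≤ 2 * l + 3 ∧ IsEvenEdgeSet x y S := by
  classical
  have h2 : ∀ m : ZMod 2, m + m = 0 := by decide
  induction hn : #W using Nat.strong_induction_on generalizing W E with | _ n ih =>
  subst hn
  by_contra hno
  push Not at hno
  obtain ⟨f₀, hf₀⟩ := hne
  set v := x f₀ with hv
  have hvW : v ∈ W := (hE f₀ hf₀).1
  -- `P` replaces a path from `v` to `w` of length at most `i`: only its boundary modulo 2 matters.
  -- `B i` is then a ball around `v`.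
  let J : ℕ → β → Finset α → Prop := fun i w P =>
    P ⊆ E ∧ #P ≤ i ∧ ∀ g : β → ZMod 2, ∑ f ∈ P, (g (x f) + g (y f)) = g v + g w
  let B : ℕ → Finset β := fun i => {w ∈ W | ∃ P, J i w P}
  have hB0 : ∀ i, v ∈ B i := fun i => by
    refine mem_filter.2 ⟨hvW, ∅, by simp, by simp, fun g => ?_⟩
    simp [h2]
  have hmono : ∀ i, B i ⊆ B (i + 1) := fun i w hw => by
    obtain ⟨h1, P, hP1, hP2, hP3⟩ := mem_filter.1 hw
    exact mem_filter.2 ⟨h1, P, hP1, hP2.trans (Nat.le_succ _), hP3⟩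
  have hstep : ∀ i f a b, f ∈ E → a ∈ B i → b ∈ W →
      (∀ g : β → ZMod 2, g (x f) + g (y f) = g a + g b) → b ∈ B (i + 1) := by
    intro i f a b hf ha hb hg
    obtain ⟨h1, P, hP1, hP2, hP3⟩ := mem_filter.1 ha
    refine mem_filter.2 ⟨hb, symmDiff P {f}, ?_, ?_, fun g => ?_⟩
    · intro e he
      rcases mem_symmDiff.1 he with h | h
      · exact hP1 h.1
      · rw [mem_singleton.1 h.1]; exact hf
    · calc #(symmDiff P {f}) ≤ #(P ∪ {f}) := card_le_card (by
            rw [← sup_eq_union]; exact symmDiff_le_sup)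
        _ ≤ #P + #{f} := card_union_le _ _
        _ ≤ i + 1 := by simpa using hP2
    · rw [sum_symmDiff_of_charTwo h2, hP3 g, sum_singleton, hg g]
      linear_combination h2 (g a)
  -- If the balls doubled `l + 1` times, they would outgrow `W`.
  have hgrow : ∃ i ≤ l, #(B (i + 1)) < 2 * #(B i) := by
    by_contra! hcon
    have : ∀ i ≤ l + 1, 2 ^ i ≤ #(B i) := by
      intro i
      induction i with
      | zero => exact fun _ => card_pos.2 ⟨v, hB0 0⟩
      | succ i IH =>
        intro hi
        have := IH (by omega)
        have := hcon i (by omega)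
        rw [pow_succ]
        omega
    have h1 := this (l + 1) le_rfl
    have h3 : #(B (l + 1)) ≤ #W := card_le_card (filter_subset _ _)
    have h4 : 0 < 2 ^ l := by positivity
    rw [pow_succ] at h1
    omega
  obtain ⟨i, hil, hi⟩ := hgrow
  let E₁ : Finset α := {f ∈ E | x f ∈ B i ∨ y f ∈ B i}
  have hmem₁ : ∀ f ∈ E₁, x f ∈ B (i + 1) ∧ y f ∈ B (i + 1) := by
    intro f hf
    obtain ⟨hfE, h | h⟩ := mem_filter.1 hf
    · exact ⟨hmono i h, hstep i f _ _ hfE h (hE f hfE).2 fun g => rfl⟩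
    · exact ⟨hstep i f _ _ hfE h (hE f hfE).1 fun g => add_comm _ _, hmono i h⟩
  have hP : ∀ w, ∃ P, w ∈ B (i + 1) → J (i + 1) w P := fun w => by
    by_cases hw : w ∈ B (i + 1)
    · obtain ⟨P, hP⟩ := (mem_filter.1 hw).2
      exact ⟨P, fun _ => hP⟩
    · exact ⟨∅, fun h => absurd h hw⟩
  choose P₀ hP₀ using hP
  let P : β → Finset α := fun w => if w = v then ∅ else P₀ w
  have hP : ∀ w ∈ B (i + 1), J (i + 1) w (P w) := by
    intro w hw
    by_cases hwv : w = v
    · simp only [P, hwv, if_true]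
      exact ⟨by simp, by simp, fun g => by simp [h2]⟩
    · simp only [P, hwv, if_false]
      exact hP₀ w hw
  -- If `f` differs from the symmetric difference of the paths to its ends, adding it to them gives
  -- a nonempty even set of size at most `1 + 2 * (i + 1) ≤ 2 * l + 3`, contrary to `hno`.
  have hlt : #E₁ < #(B (i + 1)) := by
    refine card_lt_card_of_eq_symmDiff E₁ (B (i + 1)) P v (hB0 _) (by simp [P]) x y
      (fun f hf => (hmem₁ f hf).1) (fun f hf => (hmem₁ f hf).2) fun f hf => ?_
    obtain ⟨ha1, ha2, ha3⟩ := hP _ (hmem₁ f hf).1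
    obtain ⟨hb1, hb2, hb3⟩ := hP _ (hmem₁ f hf).2
    have hfE : f ∈ E := (mem_filter.1 hf).1
    by_contra hne
    have hcardU : ∀ A C : Finset α, #(symmDiff A C) ≤ #A + #C := fun A C =>
      (card_le_card (by rw [← sup_eq_union]; exact symmDiff_le_sup)).trans (card_union_le A C)
    have hsubU : ∀ A C : Finset α, A ⊆ E → C ⊆ E → symmDiff A C ⊆ E := fun A C hA hC =>
      (show symmDiff A C ≤ A ∪ C by rw [← sup_eq_union]; exact symmDiff_le_sup).trans
        (union_subset hA hC)
    refine hno (symmDiff {f} (symmDiff (P (x f)) (P (y f))))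
      (hsubU _ _ (by simpa using hfE) (hsubU _ _ ha1 hb1)) ?_ ?_ ?_
    · rw [nonempty_iff_ne_empty]
      intro h
      exact hne (symmDiff_eq_bot.1 h)
    · have := hcardU {f} (symmDiff (P (x f)) (P (y f)))
      have := hcardU (P (x f)) (P (y f))
      simp only [card_singleton] at *
      omega
    · intro g
      rw [sum_symmDiff_of_charTwo h2, sum_symmDiff_of_charTwo h2, ha3, hb3, sum_singleton]
      linear_combination h2 (g (x f)) + h2 (g (y f)) + h2 (g v)
  have hBW : B i ⊆ W := filter_subset _ _
  have hc1 : #(W \ B i) + #(B i) = #W := card_sdiff_add_card_eq_card hBW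
  have hc2 : #(E \ E₁) + #E₁ = #E := card_sdiff_add_card_eq_card (filter_subset _ _)
  have hpos : 0 < #(B i) := card_pos.2 ⟨v, hB0 i⟩
  -- Deleting the ball loses fewer than `2 * #(B i)` edges, so the density bound persists and the
  -- strict inequality keeps the edge set nonempty.
  obtain ⟨S, hS, hS1, hS2, hS3⟩ := ih #(W \ B i) (by omega) (W \ B i) (E \ E₁) (fun f hf => by
      obtain ⟨hfE, hf1⟩ := mem_sdiff.1 hf
      have : ¬ (x f ∈ B i ∨ y f ∈ B i) := fun h => hf1 (mem_filter.2 ⟨hfE, h⟩)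
      push Not at this
      exact ⟨mem_sdiff.2 ⟨(hE f hfE).1, this.1⟩, mem_sdiff.2 ⟨(hE f hfE).2, this.2⟩⟩)
    (by omega) (card_pos.1 (by omega)) (by omega) rfl
  exact hno S (hS.trans sdiff_subset) hS1 hS2 hS3

open Finset in
theorem exists_disjoint_isEvenEdgeSets {α β : Type*} [DecidableEq α] [DecidableEq β]
    (x y : α → β) (l : ℕ) (W : Finset β) (E : Finset α) (hE : ∀ f ∈ E, x f ∈ W ∧ y f ∈ W)
    (hW : #W ≤ 2 ^ l) :
    ∃ 𝒮 : Finset (Finset α), (∀ S ∈ 𝒮, S ⊆ E ∧ #S ≤ 2 * l + 3 ∧ IsEvenEdgeSet x y S) ∧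
      (𝒮 : Set (Finset α)).PairwiseDisjoint id ∧ #(E \ 𝒮.biUnion id) ≤ 2 * #W := by
  induction hn : #E using Nat.strong_induction_on generalizing E with | _ n ih =>
  subst hn
  by_cases hcard : #E ≤ 2 * #W
  · exact ⟨∅, by simp, by simp, by simpa using hcard⟩
  obtain ⟨S, hSE, hS1, hS2, hS3⟩ := exists_short_isEvenEdgeSet x y l W E hE hW
    (card_pos.1 (by omega)) (by omega)
  obtain ⟨𝒮, h1, h2, h3⟩ := ih #(E \ S) (card_lt_card (sdiff_ssubset hSE hS1)) (E \ S)
    (fun f hf => hE f (mem_sdiff.1 hf).1) rfl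
  refine ⟨insert S 𝒮, ?_, ?_, ?_⟩
  · simp only [mem_insert, forall_eq_or_imp]
    exact ⟨⟨hSE, hS2, hS3⟩, fun R hR => ⟨(h1 R hR).1.trans sdiff_subset, (h1 R hR).2⟩⟩
  · rw [coe_insert]
    refine h2.insert fun R hR _ => ?_
    exact disjoint_sdiff.mono_right (h1 R hR).1
  · rw [biUnion_insert, id, ← sup_eq_union, ← sdiff_sdiff]
    exact h3

/-! ### Partitions with few odd parities on lower sets -/

open Finset in
/-- A finite set can be enumerated compatibly with a given function into a linear order. -/
theorem exists_rank {ι γ : Type*} [DecidableEq ι] [LinearOrder γ] (I : Finset ι) (pos : ι → γ) :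
    ∃ ρ : ι → ℕ, Set.InjOn ρ I ∧ (∀ i ∈ I, ρ i < #I) ∧
      ∀ i ∈ I, ∀ j ∈ I, pos i < pos j → ρ i < ρ j := by
  induction I using Finset.induction_on_max_value pos with
  | empty => exact ⟨fun _ => 0, by simp⟩
  | insert a s ha hmax ih =>
    obtain ⟨ρ, h1, h2, h3⟩ := ih
    have hne : ∀ i ∈ s, i ≠ a := fun i hi h => ha (h ▸ hi)
    refine ⟨Function.update ρ a #s, ?_, ?_, ?_⟩
    · intro i hi j hj hij
      simp only [coe_insert, Set.mem_insert_iff, mem_coe] at hi hj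
      rcases hi with rfl | hi <;> rcases hj with rfl | hj
      · rfl
      · rw [Function.update_self, Function.update_of_ne (hne j hj)] at hij
        have := h2 j hj
        omega
      · rw [Function.update_self, Function.update_of_ne (hne i hi)] at hij
        have := h2 i hi
        omega
      · rw [Function.update_of_ne (hne i hi), Function.update_of_ne (hne j hj)] at hij
        exact h1 hi hj hij
    · intro i hi
      rw [card_insert_of_notMem ha]
      rcases mem_insert.1 hi with rfl | hi
      · simp
      · rw [Function.update_of_ne (hne i hi)]
        have := h2 i hi
        omega
    · intro i hi j hj hij
      rcases mem_insert.1 hi with rfl | hi' <;> rcases mem_insert.1 hj with rfl | hj'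
      · exact absurd hij (lt_irrefl _)
      · exact absurd hij (hmax j hj').not_gt
      · rw [Function.update_self, Function.update_of_ne (hne i hi')]
        exact h2 i hi'
      · rw [Function.update_of_ne (hne i hi'), Function.update_of_ne (hne j hj')]
        exact h3 i hi' j hj' hij

open Finset in
open Classical in
/-- The parity of the number of endpoints in `U` of the edges in `S`. -/
noncomputable def crossParity {α γ : Type*} (a b : α → γ) (U : Set γ) (S : Finset α) : ZMod 2 :=
  ∑ f ∈ S, ((if a f ∈ U then 1 else 0) + (if b f ∈ U then 1 else 0))

open Finset in
/-- Cut the ranked endpoints of the edges in `F` into blocks of length `16`. Among disjoint sets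
of edges that are even with respect to the blocks, few have odd parity on a given lower set. -/
theorem card_filter_crossParity_le {α γ : Type*} [DecidableEq α] [LinearOrder γ] (a b : α → γ)
    (F : Finset α) (ρ : α ⊕ α → ℕ) (hinj : Set.InjOn ρ (F.disjSum F))
    (hmono : ∀ i ∈ F.disjSum F, ∀ j ∈ F.disjSum F,
      Sum.elim a b i < Sum.elim a b j → ρ i < ρ j)
    (𝒮 : Finset (Finset α)) (h𝒮 : ∀ S ∈ 𝒮, S ⊆ F ∧
      IsEvenEdgeSet (fun f => ρ (.inl f) / 16) (fun f => ρ (.inr f) / 16) S)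
    (hdisj : (𝒮 : Set (Finset α)).PairwiseDisjoint id) (U : Set γ) (hU : IsLowerSet U) :
    #{S ∈ 𝒮 | crossParity a b U S = 1} ≤ 16 := by
  classical
  set I := F.disjSum F with hI
  set pos := Sum.elim a b with hpos
  -- Blocks meeting both `U` and its complement. Since ranks respect the order, there is at most
  -- one.
  let Mixed : ℕ → Prop := fun w =>
    (∃ i ∈ I, ρ i / 16 = w ∧ pos i ∈ U) ∧ ∃ j ∈ I, ρ j / 16 = w ∧ pos j ∉ U
  have hlt : ∀ i ∈ I, ∀ j ∈ I, pos i ∈ U → pos j ∉ U → ρ i < ρ j := by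
    intro i hi j hj hiU hjU
    refine hmono i hi j hj (lt_of_not_ge fun h => hjU (hU h hiU))
  have huniq : ∀ w w', Mixed w → Mixed w' → w = w' := by
    rintro w w' ⟨⟨i, hi, hiw, hiU⟩, j, hj, hjw, hjU⟩ ⟨⟨i', hi', hiw', hiU'⟩, j', hj', hjw', hjU'⟩
    have h1 := hlt i hi j' hj' hiU hjU'
    have h2 := hlt i' hi' j hj hiU' hjU
    omega
  have htouch : ∀ S ∈ 𝒮, crossParity a b U S = 1 →
      ∃ i ∈ I, Mixed (ρ i / 16) ∧ Sum.elim id id i ∈ S := by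
    intro S hS hpar
    by_contra! hno
    -- On unmixed blocks membership in `U` depends on the block alone, so evenness of `S` tested
    -- against `g` makes its parity vanish.
    let g : ℕ → ZMod 2 := fun w => if ∃ i ∈ I, ρ i / 16 = w ∧ pos i ∈ U then 1 else 0
    have hg : ∀ i ∈ I, Sum.elim id id i ∈ S → g (ρ i / 16) = if pos i ∈ U then 1 else 0 := by
      intro i hi hiS
      have hmix := fun h => hno i hi h hiS
      by_cases hiU : pos i ∈ U
      · simp only [g, hiU, if_true]
        exact if_pos ⟨i, hi, rfl, hiU⟩
      · simp only [g, hiU, if_false]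
        exact if_neg fun h => hmix ⟨h, i, hi, rfl, hiU⟩
    have h0 := (h𝒮 S hS).2 g
    have : crossParity a b U S = 0 := by
      rw [← h0, crossParity]
      refine sum_congr rfl fun f hf => ?_
      have hfF := (h𝒮 S hS).1 hf
      rw [hg (.inl f) (by simpa [hI] using hfF) (by simpa using hf),
        hg (.inr f) (by simpa [hI] using hfF) (by simpa using hf)]
      simp [hpos]
    rw [this] at hpar
    exact absurd hpar (by decide)
  rcases ({S ∈ 𝒮 | crossParity a b U S = 1} : Finset _).eq_empty_or_nonempty with he | ⟨S₀, hS₀⟩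
  · simp [he]
  obtain ⟨i₀, -, hm₀, -⟩ := htouch S₀ (mem_filter.1 hS₀).1 (mem_filter.1 hS₀).2
  have : Nonempty (α ⊕ α) := ⟨i₀⟩
  choose! i hiI him hiS using htouch
  calc #{S ∈ 𝒮 | crossParity a b U S = 1}
      ≤ #(Ico (16 * (ρ i₀ / 16)) (16 * (ρ i₀ / 16) + 16)) := by
        refine card_le_card_of_injOn (fun S => ρ (i S)) (fun S hS => ?_) ?_
        · obtain ⟨h1, h2⟩ := mem_filter.1 (mem_coe.1 hS)
          have := huniq _ _ (him S h1 h2) hm₀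
          simp only [coe_Ico, Set.mem_Ico]
          omega
        · intro S hS R hR hSR
          obtain ⟨h1, h2⟩ := mem_filter.1 (mem_coe.1 hS)
          obtain ⟨h3, h4⟩ := mem_filter.1 (mem_coe.1 hR)
          have hi : i S = i R := hinj (hiI S h1 h2) (hiI R h3 h4) hSR
          by_contra hne
          refine disjoint_left.1 (hdisj h1 h3 hne) (hiS S h1 h2) ?_
          rw [hi]
          exact hiS R h3 h4
    _ = 16 := by simp

open Finset in
/-- Every set of edges between points of a linear order can be partitioned into sets of
logarithmic size, few of which have odd parity on any given lower set. -/
theorem exists_partition_crossParity_le {α γ : Type*} [DecidableEq α] [LinearOrder γ]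
    (a b : α → γ) (l t : ℕ) (htl : t ≤ l) (F : Finset α) (hF : #F < 2 ^ t) :
    ∃ 𝒮 : Finset (Finset α), (∀ S ∈ 𝒮, S ⊆ F ∧ #S ≤ 2 * l + 3) ∧
      (𝒮 : Set (Finset α)).PairwiseDisjoint id ∧ 𝒮.biUnion id = F ∧
      ∀ U : Set γ, IsLowerSet U → #{S ∈ 𝒮 | crossParity a b U S = 1} ≤ 16 * t := by
  induction t generalizing F with
  | zero =>
    have : F = ∅ := by simpa using hF
    subst this
    exact ⟨∅, by simp⟩
  | succ t ih =>
    by_cases hsmall : #F ≤ 3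
    · refine ⟨F.image fun f => {f}, ?_, ?_, ?_, fun U _ => ?_⟩
      · simp only [mem_image, forall_exists_index, and_imp, forall_apply_eq_imp_iff₂,
          singleton_subset_iff, card_singleton]
        exact fun f hf => ⟨hf, by omega⟩
      · intro S hS R hR hne
        simp only [coe_image, Set.mem_image, mem_coe] at hS hR
        obtain ⟨f, -, rfl⟩ := hS
        obtain ⟨g, -, rfl⟩ := hR
        simpa [Function.onFun] using fun h : f = g => hne (by rw [h])
      · ext f
        simp
      · have h1 := card_filter_le (F.image fun f => ({f} : Finset α))
          (fun S => crossParity a b U S = 1)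
        have h2 : #(F.image fun f => ({f} : Finset α)) ≤ #F := card_image_le
        omega
    obtain ⟨ρ, hinj, hlt, hmono⟩ := exists_rank (F.disjSum F) (Sum.elim a b)
    rw [card_disjSum] at hlt
    -- The `2 * #F` endpoints fit into `#F / 8 + 1` blocks. At most twice that many edges are left
    -- over, which is below `2 ^ t` once `#F ≥ 4`.
    obtain ⟨𝒮, h1, h2, h3⟩ := exists_disjoint_isEvenEdgeSets (fun f => ρ (.inl f) / 16)
      (fun f => ρ (.inr f) / 16) l (range (#F / 8 + 1)) F (fun f hf => by
        have := hlt (.inl f) (by simpa using hf)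
        have := hlt (.inr f) (by simpa using hf)
        simp only [mem_range]
        omega) (by
        have : 2 ^ (t + 1) ≤ 2 ^ l := Nat.pow_le_pow_right (by norm_num) htl
        rw [card_range]
        omega)
    rw [card_range] at h3
    obtain ⟨𝒯, g1, g2, g3, g4⟩ := ih (by omega) (F \ 𝒮.biUnion id) (by
      rw [pow_succ] at hF
      omega)
    have hST : ∀ S ∈ 𝒮, ∀ T ∈ 𝒯, Disjoint S T := fun S hS T hT =>
      disjoint_sdiff.mono (subset_biUnion_of_mem id hS) (g1 T hT).1
    refine ⟨𝒮 ∪ 𝒯, ?_, ?_, ?_, fun U hU => ?_⟩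
    · intro S hS
      rcases mem_union.1 hS with h | h
      · exact ⟨(h1 S h).1, (h1 S h).2.1⟩
      · exact ⟨(g1 S h).1.trans sdiff_subset, (g1 S h).2⟩
    · rw [coe_union]
      exact Set.PairwiseDisjoint.union h2 g2 fun S hS T hT _ => hST S hS T hT
    · rw [union_biUnion, g3]
      exact union_sdiff_of_subset (biUnion_subset.2 fun S hS => (h1 S hS).1)
    · have k1 := card_filter_crossParity_le a b F ρ hinj hmono 𝒮
        (fun S hS => ⟨(h1 S hS).1, (h1 S hS).2.2⟩) h2 U hU
      have k2 := g4 U hU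
      have k3 := card_union_le {S ∈ 𝒮 | crossParity a b U S = 1}
        {S ∈ 𝒯 | crossParity a b U S = 1}
      rw [filter_union]
      omega

/-! ### Few subsets that catch every point -/

open Finset in
/-- Some subset of `F` has odd total on at least half of the points of `Q`. -/
theorem exists_subset_sum_eq_one {α κ : Type*} [DecidableEq α] (F : Finset α) (ζ : α → κ → ZMod 2)
    (Q : Finset κ) (hQ : ∀ e ∈ Q, ∃ f ∈ F, ζ f e = 1) (φ : κ → ZMod 2) :
    ∃ S ⊆ F, #Q ≤ 2 * #{e ∈ Q | φ e + ∑ f ∈ S, ζ f e = 1} := by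
  classical
  induction F using Finset.induction_on generalizing Q φ with
  | empty =>
    have : Q = ∅ := eq_empty_of_forall_notMem fun e he => by simpa using hQ e he
    exact ⟨∅, by simp, by simp [this]⟩
  | insert f F hf ih =>
    let P := {e ∈ Q | ∃ f ∈ F, ζ f e = 1}
    let R := {e ∈ Q | ¬ ∃ f ∈ F, ζ f e = 1}
    have hPR : #P + #R = #Q := card_filter_add_card_filter_not _
    have hR : ∀ S ⊆ F, ∀ e ∈ R, ∑ f ∈ S, ζ f e = 0 := by
      intro S hS e he
      refine sum_eq_zero fun g hg => ?_
      have h := (mem_filter.1 he).2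
      push Not at h
      have := h g (hS hg)
      generalize ζ g e = z at *
      revert z; decide
    have hRf : ∀ e ∈ R, ζ f e = 1 := by
      intro e he
      obtain ⟨heQ, h⟩ := mem_filter.1 he
      obtain ⟨g, hg, hge⟩ := hQ e heQ
      rcases mem_insert.1 hg with rfl | hg
      · exact hge
      · exact absurd ⟨g, hg, hge⟩ h
    have hsplit : ∀ (p : κ → Prop) [DecidablePred p], #{e ∈ P | p e} + #{e ∈ R | p e} = #{e ∈ Q | p e} := by
      intro p _
      rw [← card_filter_add_card_filter_not (s := {e ∈ Q | p e}) fun e => ∃ f ∈ F, ζ f e = 1]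
      simp only [P, R, filter_filter, and_comm]
    -- Derandomisation: on `R` only `f` can still change the total, so a majority vote there decides
    -- whether to take `f`. The offset `φ` records the choices already made.
    by_cases hmaj : #R ≤ 2 * #{e ∈ R | φ e = 1}
    · obtain ⟨S, hS, h⟩ := ih P (fun e he => (mem_filter.1 he).2) φ
      refine ⟨S, hS.trans (subset_insert _ _), ?_⟩
      rw [← hsplit]
      have : ({e ∈ R | φ e + ∑ f ∈ S, ζ f e = 1} : Finset κ) = {e ∈ R | φ e = 1} :=
        filter_congr fun e he => by rw [hR S hS e he, add_zero]
      rw [this]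
      omega
    · obtain ⟨S, hS, h⟩ := ih P (fun e he => (mem_filter.1 he).2) fun e => φ e + ζ f e
      refine ⟨insert f S, insert_subset_insert _ hS, ?_⟩
      have hfS : f ∉ S := fun h => hf (hS h)
      rw [← hsplit]
      simp only [sum_insert hfS, ← add_assoc]
      have h1 : ({e ∈ R | φ e + ζ f e + ∑ f ∈ S, ζ f e = 1} : Finset κ) = {e ∈ R | ¬ φ e = 1} :=
        filter_congr fun e he => by
          rw [hR S hS e he, add_zero, hRf e he]
          generalize φ e = z
          revert z; decide
      have h2 : #{e ∈ R | φ e = 1} + #{e ∈ R | ¬ φ e = 1} = #R := card_filter_add_card_filter_not _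
      rw [h1]
      omega

-- Each chosen subset settles at least half of the remaining points, so `t` rounds exhaust fewer
-- than `2 ^ t` points.
open Finset in
theorem exists_family_sum_eq_one {α κ : Type*} [DecidableEq α] (F : Finset α) (ζ : α → κ → ZMod 2)
    (t : ℕ) (Q : Finset κ) (hQ : ∀ e ∈ Q, ∃ f ∈ F, ζ f e = 1) (ht : #Q < 2 ^ t) :
    ∃ ℱ : Finset (Finset α), #ℱ ≤ t ∧ (∀ S ∈ ℱ, S ⊆ F) ∧
      ∀ e ∈ Q, ∃ S ∈ ℱ, ∑ f ∈ S, ζ f e = 1 := by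
  classical
  induction t generalizing Q with
  | zero =>
    have : Q = ∅ := by simpa using ht
    exact ⟨∅, by simp [this]⟩
  | succ t ih =>
    obtain ⟨S, hS, h⟩ := exists_subset_sum_eq_one F ζ Q hQ 0
    simp only [Pi.zero_apply, zero_add] at h
    have h2 : #{e ∈ Q | ∑ f ∈ S, ζ f e = 1} + #{e ∈ Q | ¬ ∑ f ∈ S, ζ f e = 1} = #Q :=
      card_filter_add_card_filter_not _
    obtain ⟨ℱ, h3, h4, h5⟩ := ih {e ∈ Q | ¬ ∑ f ∈ S, ζ f e = 1}
      (fun e he => hQ e (mem_filter.1 he).1) (by rw [pow_succ] at ht; omega)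
    refine ⟨insert S ℱ, (card_insert_le _ _).trans (by omega), ?_, fun e he => ?_⟩
    · simpa [hS] using h4
    · by_cases heS : ∑ f ∈ S, ζ f e = 1
      · exact ⟨S, by simp, heS⟩
      · obtain ⟨R, hR, h⟩ := h5 e (mem_filter.2 ⟨he, heS⟩)
        exact ⟨R, by simp [hR], h⟩

/-! ### Root paths and the lexicographic order -/

theorem List.prefix_of_le_of_le {α : Type*} [LinearOrder α] {p a b c : List α} (ha : p <+: a)
    (hc : p <+: c) (hab : a ≤ b) (hbc : b ≤ c) : p <+: b := by
  induction p generalizing a b c with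
  | nil => exact List.nil_prefix
  | cons x p ih =>
    obtain ⟨a, rfl⟩ := ha
    obtain ⟨c, rfl⟩ := hc
    rw [List.cons_append] at hab hbc
    cases b with
    | nil => exact absurd hab (by simp)
    | cons y b =>
      rw [← not_lt, List.cons_lt_cons_iff] at hab hbc
      push Not at hab hbc
      have hxy : x = y := le_antisymm hab.1 hbc.1
      subst hxy
      rw [List.prefix_cons_inj]
      exact ih (List.prefix_append _ _) (List.prefix_append _ _) (hab.2 rfl) (hbc.2 rfl)

namespace SimpleGraph.IsTree

variable {V : Type*} {T : SimpleGraph V} (hT : T.IsTree) (r : V)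

/-- The path of a tree from its root `r` to `v`. -/
noncomputable def rootPath (v : V) : T.Walk r v := (hT.existsUnique_path r v).choose

theorem isPath_rootPath (v : V) : (hT.rootPath r v).IsPath :=
  (hT.existsUnique_path r v).choose_spec.1

theorem eq_rootPath {v : V} {p : T.Walk r v} (hp : p.IsPath) : p = hT.rootPath r v :=
  (hT.existsUnique_path r v).choose_spec.2 p hp

theorem notMem_edges_rootPath {e : Sym2 V} (he : e ∉ T.edgeSet) (v : V) :
    e ∉ (hT.rootPath r v).edges :=
  fun h => he ((hT.rootPath r v).edges_subset_edgeSet h)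

theorem length_rootPath (v : V) : (hT.rootPath r v).length = T.dist r v := by
  obtain ⟨p, hp, h⟩ := hT.1.exists_path_of_dist r v
  rw [← hT.eq_rootPath r hp, h]

theorem length_rootPath_le [Fintype V] (v : V) : (hT.rootPath r v).length ≤ treeDepth T r := by
  rw [hT.length_rootPath]
  exact Finset.le_sup (f := fun v => T.dist r v) (Finset.mem_univ v)

theorem rootPath_eq_concat {v w : V} (h : T.Adj v w) :
    hT.rootPath r w = (hT.rootPath r v).concat h ∨
      hT.rootPath r v = (hT.rootPath r w).concat h.symm := by
  by_cases hv : v ∈ (hT.rootPath r w).support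
  · exact .inl (hT.2.path_concat (hT.isPath_rootPath r v) (hT.isPath_rootPath r w) h hv)
  · exact .inr (hT.2.path_concat (hT.isPath_rootPath r w) (hT.isPath_rootPath r v) h.symm
      (hT.2.mem_support_of_ne_mem_support_of_adj_of_isPath (hT.isPath_rootPath r v)
        (hT.isPath_rootPath r w) h hv))

/-- Root paths of tree neighbours differ only by the edge joining them, so along the tree the
property of lying below `e` changes only across `e` itself. -/
theorem mem_edges_rootPath_iff_of_ne {v w : V} (h : T.Adj v w) {e : Sym2 V} (he : e ≠ s(v, w)) :
    e ∈ (hT.rootPath r v).edges ↔ e ∈ (hT.rootPath r w).edges := by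
  rcases hT.rootPath_eq_concat r h with h' | h'
  · rw [h', Walk.edges_concat]
    simp [he]
  · rw [h', Walk.edges_concat]
    rw [Sym2.eq_swap] at he
    simp [he]

theorem mem_edges_rootPath_iff_not {v w : V} (h : T.Adj v w) :
    s(v, w) ∈ (hT.rootPath r v).edges ↔ s(v, w) ∉ (hT.rootPath r w).edges := by
  rcases hT.rootPath_eq_concat r h with h' | h'
  · have h1 := (hT.isPath_rootPath r w).edges_nodup
    have h2 : s(v, w) ∈ (hT.rootPath r w).edges := by rw [h', Walk.edges_concat]; simp
    simp only [h2, not_true_eq_false, iff_false]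
    rw [h', Walk.edges_concat, List.concat_eq_append, List.nodup_append] at h1
    intro h3
    exact h1.2.2 _ h3 _ (by simp) rfl
  · have h1 := (hT.isPath_rootPath r v).edges_nodup
    have h2 : s(v, w) ∈ (hT.rootPath r v).edges := by
      rw [h', Walk.edges_concat, Sym2.eq_swap]; simp
    simp only [h2, true_iff]
    rw [h', Walk.edges_concat, List.concat_eq_append, List.nodup_append] at h1
    intro h3
    exact h1.2.2 _ h3 _ (by simp) Sym2.eq_swap

/-- The vertices below an edge of a tree are those whose root path extends a given one. -/
theorem exists_mem_edges_rootPath_iff_prefix [DecidableEq V] {e : Sym2 V} (he : e ∈ T.edgeSet) :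
    ∃ c, ∀ v, e ∈ (hT.rootPath r v).edges ↔
      (hT.rootPath r c).edges <+: (hT.rootPath r v).edges := by
  have key : ∀ p c : V, T.Adj p c → s(p, c) ∈ (hT.rootPath r c).edges → ∀ v,
      s(p, c) ∈ (hT.rootPath r v).edges ↔
      (hT.rootPath r c).edges <+: (hT.rootPath r v).edges := by
    intro p c hpc hc v
    refine ⟨fun h => ?_, fun h => h.subset hc⟩
    have hcv := (hT.rootPath r v).snd_mem_support_of_mem_edges h
    rw [← hT.eq_rootPath r ((hT.isPath_rootPath r v).takeUntil hcv)]
    exact Walk.edges_takeUntil_prefix_edges _ _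
  induction e with | _ v w =>
  have h : T.Adj v w := he
  by_cases hw : s(v, w) ∈ (hT.rootPath r w).edges
  · exact ⟨w, key v w h hw⟩
  · have := (hT.mem_edges_rootPath_iff_not r h).2 hw
    rw [Sym2.eq_swap] at this ⊢
    exact ⟨v, key w v h.symm this⟩

/-- The vertices below an edge of a tree form an interval in the lexicographic order. -/
theorem exists_lowerSets [Fintype V] [DecidableEq V] (enc : Sym2 V → ℕ)
    (henc : Function.Injective enc) {e : Sym2 V} (he : e ∈ T.edgeSet) :
    ∃ U₁ U₂ : Set (List ℕ), IsLowerSet U₁ ∧ IsLowerSet U₂ ∧ U₂ ⊆ U₁ ∧ ∀ v,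
      e ∈ (hT.rootPath r v).edges ↔ (hT.rootPath r v).edges.map enc ∈ U₁ \ U₂ := by
  obtain ⟨c, hc⟩ := hT.exists_mem_edges_rootPath_iff_prefix r he
  set p := (hT.rootPath r c).edges.map enc with hp
  -- The lists up to some extension of `p`, minus those before every extension: by convexity,
  -- exactly the extensions of `p`.
  refine ⟨{x | ∃ y, p <+: y ∧ x ≤ y}, {x | ∀ y, p <+: y → x < y}, ?_, ?_, ?_, fun v => ?_⟩
  · rintro x x' hx ⟨y, hy, hxy⟩
    exact ⟨y, hy, hx.trans hxy⟩
  · intro x x' hx h y hy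
    exact hx.trans_lt (h y hy)
  · intro x hx
    exact ⟨p, List.prefix_rfl, (hx p List.prefix_rfl).le⟩
  · rw [hc, ← List.prefix_map_iff_of_injective henc]
    refine ⟨fun h => ⟨⟨_, h, le_rfl⟩, fun h' => lt_irrefl _ (h' _ h)⟩, ?_⟩
    rintro ⟨⟨y, hy, hvy⟩, h⟩
    simp only [Set.mem_ofPred_eq, not_forall, not_lt] at h
    obtain ⟨z, hz, hzv⟩ := h
    exact List.prefix_of_le_of_le hz hy hzv hvy

end SimpleGraph.IsTree

/-! ### Breadth-first spanning trees -/

/-- A connected finite graph has a spanning tree preserving the distances to a given root. -/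
theorem SimpleGraph.Connected.exists_isTree_dist_le {V : Type*} [Finite V] {G : SimpleGraph V}
    (hG : G.Connected) (r : V) : ∃ T ≤ G, T.IsTree ∧ ∀ v, T.dist r v ≤ G.dist r v := by
  classical
  have := Fintype.ofFinite V
  have hpar : ∀ v, ∃ u, v ≠ r → G.Adj u v ∧ G.dist r v = G.dist r u + 1 := by
    intro v
    by_cases hv : v = r
    · exact ⟨v, fun h => absurd hv h⟩
    obtain ⟨p, hp⟩ := (hG v r).exists_walk_length_eq_dist
    cases p with
    | nil => exact absurd rfl hv
    | @cons _ u _ h p =>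
      refine ⟨u, fun _ => ⟨h.symm, ?_⟩⟩
      rw [Walk.length_cons] at hp
      have h1 := dist_le p
      have h2 : G.dist r v ≤ G.dist r u + G.dist u v := hG.dist_triangle
      rw [dist_eq_one_iff_adj.2 h.symm] at h2
      rw [dist_comm (u := v)] at hp
      rw [dist_comm (u := u)] at h1
      omega
  choose par hpar using hpar
  let E : Finset (Sym2 V) := (Finset.univ.erase r).image fun v => s(par v, v)
  let T : SimpleGraph V := fromEdgeSet (E : Set (Sym2 V))
  have hadj : ∀ v, v ≠ r → T.Adj (par v) v := by
    intro v hv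
    rw [fromEdgeSet_adj]
    exact ⟨by simpa [E] using ⟨v, hv, .inl ⟨rfl, rfl⟩⟩, (hpar v hv).1.ne⟩
  have hwalk : ∀ n v, G.dist r v = n → ∃ p : T.Walk r v, p.length = n := by
    intro n
    induction n with
    | zero =>
      intro v hv
      rw [hG.dist_eq_zero_iff] at hv
      subst hv
      exact ⟨.nil, rfl⟩
    | succ n ih =>
      intro v hv
      have hvr : v ≠ r := by rintro rfl; simp at hv
      obtain ⟨p, hp⟩ := ih (par v) (by have := (hpar v hvr).2; omega)
      exact ⟨p.concat (hadj v hvr), by simp [hp]⟩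
  have hTG : T ≤ G := by
    intro a b hab
    rw [fromEdgeSet_adj] at hab
    obtain ⟨v, hv, h⟩ := Finset.mem_image.1 (Finset.mem_coe.1 hab.1)
    rw [← mem_edgeSet, ← h]
    exact (hpar v (Finset.ne_of_mem_erase hv)).1
  have hconn : T.Connected := by
    have : Nonempty V := ⟨r⟩
    refine ⟨fun a b => ?_⟩
    obtain ⟨p, -⟩ := hwalk _ a rfl
    obtain ⟨q, -⟩ := hwalk _ b rfl
    exact ⟨p.reverse.append q⟩
  refine ⟨T, hTG, ?_, fun v => ?_⟩
  · rw [isTree_iff_connected_and_card]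
    refine ⟨hconn, le_antisymm ?_ hconn.card_vert_le_card_edgeSet_add_one⟩
    have h1 : Nat.card T.edgeSet ≤ E.card := by
      rw [Nat.card_coe_set_eq, ← Set.ncard_coe_finset E]
      refine Set.ncard_le_ncard (fun e he => ?_) E.finite_toSet
      rw [edgeSet_fromEdgeSet] at he
      exact he.1
    have h2 : E.card ≤ (Finset.univ.erase r).card := Finset.card_image_le
    rw [Finset.card_erase_of_mem (Finset.mem_univ r), Finset.card_univ] at h2
    have h3 : 0 < Fintype.card V := Fintype.card_pos_iff.2 ⟨r⟩
    rw [Nat.card_eq_fintype_card (α := V)]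
    omega
  · obtain ⟨p, hp⟩ := hwalk _ v rfl
    exact hp ▸ dist_le p

theorem SimpleGraph.Connected.exists_isTree_treeDepth_le {V : Type*} [Fintype V]
    {G : SimpleGraph V} (hG : G.Connected) :
    ∃ T ≤ G, T.IsTree ∧ ∃ r, treeDepth T r ≤ G.diam := by
  obtain ⟨r⟩ := hG.nonempty
  obtain ⟨T, hT, hT', h⟩ := hG.exists_isTree_dist_le r
  have : Nonempty V := ⟨r⟩
  exact ⟨T, hT, hT', r, Finset.sup_le fun v _ =>
    (h v).trans (dist_le_diam (connected_iff_ediam_ne_top.1 hG))⟩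

/-! ### Sums of fundamental cycles -/

namespace SimpleGraph.IsTree

variable {V : Type*} [DecidableEq V] {T : SimpleGraph V} (hT : T.IsTree) (r : V)
  (a b : Sym2 V → V)

/-- The edge set, as a vector over `ZMod 2`, of the cycle that the edge `f` with endpoints `a f`
and `b f` closes in the tree `T`. -/
noncomputable def cycleVec (f e : Sym2 V) : ZMod 2 :=
  (if e = f then 1 else 0) + (if e ∈ (hT.rootPath r (a f)).edges then 1 else 0) +
    (if e ∈ (hT.rootPath r (b f)).edges then 1 else 0)

open Finset in
/-- The sum modulo 2 of the fundamental cycles of the edges in `S`. -/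
noncomputable def cycleSum [Fintype V] (S : Finset (Sym2 V)) : Finset (Sym2 V) :=
  {e | ∑ f ∈ S, hT.cycleVec r a b f e = 1}

theorem sum_cycleVec_of_notMem {e : Sym2 V} (he : e ∉ T.edgeSet) (S : Finset (Sym2 V)) :
    ∑ f ∈ S, hT.cycleVec r a b f e = if e ∈ S then 1 else 0 := by
  simp [cycleVec, hT.notMem_edges_rootPath r he]

theorem cycleVec_of_mem {e f : Sym2 V} (he : e ∈ T.edgeSet) (hf : f ∉ T.edgeSet) :
    hT.cycleVec r a b f e = (if e ∈ (hT.rootPath r (a f)).edges then 1 else 0) +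
      (if e ∈ (hT.rootPath r (b f)).edges then 1 else 0) := by
  have : e ≠ f := by rintro rfl; exact hf he
  simp [cycleVec, this]

open Finset in
theorem mem_cycleSum [Fintype V] {S : Finset (Sym2 V)} {e : Sym2 V} :
    e ∈ hT.cycleSum r a b S ↔ ∑ f ∈ S, hT.cycleVec r a b f e = 1 := by
  simp [cycleSum]

open Finset in
theorem mem_edgeSet_of_mem_cycleSum [Fintype V] {G : SimpleGraph V} (hTG : T ≤ G)
    {S : Finset (Sym2 V)} (hS : ∀ f ∈ S, f ∈ G.edgeSet) :
    ∀ e ∈ hT.cycleSum r a b S, e ∈ G.edgeSet := by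
  intro e he
  by_cases heT : e ∈ T.edgeSet
  · exact edgeSet_mono hTG heT
  · rw [mem_cycleSum, hT.sum_cycleVec_of_notMem r a b heT] at he
    split_ifs at he with h
    · exact hS e h
    · exact absurd he (by decide)

open Finset in
theorem card_cycleSum_le [Fintype V] (S : Finset (Sym2 V)) :
    #(hT.cycleSum r a b S) ≤ #S * (2 * treeDepth T r + 1) := by
  let A : Sym2 V → Finset (Sym2 V) := fun f =>
    insert f ((hT.rootPath r (a f)).edges.toFinset ∪ (hT.rootPath r (b f)).edges.toFinset)
  have hsub : hT.cycleSum r a b S ⊆ S.biUnion A := by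
    intro e he
    rw [mem_cycleSum] at he
    obtain ⟨f, hf, hfe⟩ : ∃ f ∈ S, hT.cycleVec r a b f e ≠ 0 := by
      by_contra! h
      rw [sum_eq_zero h] at he
      exact absurd he (by decide)
    rw [mem_biUnion]
    refine ⟨f, hf, ?_⟩
    by_contra hno
    simp only [A, mem_insert, mem_union, List.mem_toFinset, not_or] at hno
    exact hfe (by simp [cycleVec, hno])
  have hlen : ∀ v, #(hT.rootPath r v).edges.toFinset ≤ treeDepth T r := fun v =>
    (List.toFinset_card_le _).trans (by
      rw [Walk.length_edges]
      exact hT.length_rootPath_le r v)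
  refine (card_le_card hsub).trans (card_biUnion_le_card_mul _ _ _ fun f _ => ?_)
  have h1 := card_insert_le f
    ((hT.rootPath r (a f)).edges.toFinset ∪ (hT.rootPath r (b f)).edges.toFinset)
  have h2 := card_union_le (hT.rootPath r (a f)).edges.toFinset
    (hT.rootPath r (b f)).edges.toFinset
  have h3 := hlen (a f)
  have h4 := hlen (b f)
  simp only [A]
  omega

-- The boundary of a path modulo 2 is the sum of its two ends; if they coincide, both sides vanish.
open Finset in
theorem sum_mem_edges_rootPath [Fintype V] (x v : V) :
    (∑ e : Sym2 V with x ∈ e, if e ∈ (hT.rootPath r v).edges then (1 : ZMod 2) else 0) =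
      (if x = r then 1 else 0) + if x = v then 1 else 0 := by
  have h := (hT.isPath_rootPath r v).isTrail.even_countP_edges_iff x
  have hc : ((hT.rootPath r v).edges.countP fun e => x ∈ e) =
      #{e : Sym2 V | x ∈ e ∧ e ∈ (hT.rootPath r v).edges} := by
    rw [List.countP_eq_length_filter, ← List.toFinset_card_of_nodup
      ((hT.isPath_rootPath r v).isTrail.edges_nodup.filter _)]
    congr 1
    ext e
    simp [and_comm]
  rw [hc] at h
  rw [sum_boole, filter_filter]
  by_cases h1 : Even #{e : Sym2 V | x ∈ e ∧ e ∈ (hT.rootPath r v).edges}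
  · rw [ZMod.natCast_eq_zero_iff_even.2 h1]
    have := h.1 h1
    by_cases hr : x = r <;> by_cases hv : x = v <;> grind
  · rw [ZMod.natCast_eq_one_iff_odd.2 (Nat.not_even_iff_odd.1 h1)]
    rw [h] at h1
    push Not at h1
    by_cases hr : x = r <;> by_cases hv : x = v <;> grind

open Finset in
theorem even_card_filter_cycleSum [Fintype V] (hab : ∀ f, s(a f, b f) = f)
    {S : Finset (Sym2 V)} (hS : ∀ f ∈ S, ¬ f.IsDiag) (x : V) :
    Even #{e ∈ hT.cycleSum r a b S | x ∈ e} := by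
  rw [← ZMod.natCast_eq_zero_iff_even]
  have h1 : ((#{e ∈ hT.cycleSum r a b S | x ∈ e} : ℕ) : ZMod 2) =
      ∑ e : Sym2 V with x ∈ e, ∑ f ∈ S, hT.cycleVec r a b f e := by
    rw [cycleSum, filter_filter, filter_congr fun e _ => and_comm, ← filter_filter, ← sum_boole]
    refine sum_congr rfl fun e _ => ?_
    generalize ∑ f ∈ S, hT.cycleVec r a b f e = z
    revert z; decide
  rw [h1, sum_comm]
  refine sum_eq_zero fun f hf => ?_
  simp only [cycleVec, sum_add_distrib, hT.sum_mem_edges_rootPath]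
  have hne : a f ≠ b f := fun h => hS f hf (by rw [← hab f, h]; simp)
  have h2 : (∑ e : Sym2 V with x ∈ e, if e = f then (1 : ZMod 2) else 0) =
      (if x = a f then 1 else 0) + if x = b f then 1 else 0 := by
    rw [sum_ite_eq']
    have : x ∈ f ↔ x = a f ∨ x = b f := by
      conv_lhs => rw [← hab f]
      exact Sym2.mem_iff
    simp only [mem_filter, mem_univ, true_and, this]
    by_cases h1 : x = a f <;> by_cases h2 : x = b f <;> grind
  rw [h2]
  generalize (if x = a f then (1 : ZMod 2) else 0) = z₁
  generalize (if x = b f then (1 : ZMod 2) else 0) = z₂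
  generalize (if x = r then (1 : ZMod 2) else 0) = z₃
  revert z₁ z₂ z₃; decide

/-- Every edge on a cycle of `G` lies on the fundamental cycle of an edge outside `T`. -/
theorem exists_cycleVec_eq_one {G : SimpleGraph V} (hab : ∀ f, s(a f, b f) = f)
    {e : Sym2 V} (he : e ∈ cycleEdges G) :
    ∃ f ∈ G.edgeSet \ T.edgeSet, hT.cycleVec r a b f e = 1 := by
  obtain ⟨C, ⟨v, p, hp, rfl⟩, heC⟩ := he
  rw [List.mem_toFinset] at heC
  by_cases heT : e ∈ T.edgeSet
  swap
  · exact ⟨e, ⟨p.edges_subset_edgeSet heC, heT⟩, by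
      simp [cycleVec, hT.notMem_edges_rootPath r heT]⟩
  by_contra! hno
  -- If no fundamental cycle uses `e`, lying below `e` is constant along walks avoiding `e`. Since
  -- `e` is no bridge, such a walk joins its ends, of which exactly one is below `e`.
  have hinv : ∀ x y, (G.deleteEdges {e}).Adj x y →
      (e ∈ (hT.rootPath r x).edges ↔ e ∈ (hT.rootPath r y).edges) := by
    intro x y hxy
    rw [deleteEdges_adj] at hxy
    by_cases hxyT : T.Adj x y
    · exact hT.mem_edges_rootPath_iff_of_ne r hxyT fun h => hxy.2 (by simp [h])
    · have h := hno s(x, y) ⟨hxy.1, hxyT⟩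
      rw [hT.cycleVec_of_mem r a b heT hxyT] at h
      have h' : (e ∈ (hT.rootPath r (a s(x, y))).edges ↔
          e ∈ (hT.rootPath r (b s(x, y))).edges) := by
        by_cases h1 : e ∈ (hT.rootPath r (a s(x, y))).edges <;>
          by_cases h2 : e ∈ (hT.rootPath r (b s(x, y))).edges <;> simp [h1, h2] at h ⊢
      rcases Sym2.eq_iff.1 (hab s(x, y)) with ⟨h1, h2⟩ | ⟨h1, h2⟩
      · rwa [h1, h2] at h'
      · rw [h1, h2] at h'
        exact h'.symm
  induction e with | _ x y =>
  have hbridge : ¬ G.IsBridge s(x, y) := fun h => h.notMem_edges_of_isCycle hp heC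
  have hreach : (G.deleteEdges {s(x, y)}).Reachable x y := by
    by_contra h
    exact hbridge (by simpa [isBridge_iff] using h)
  obtain ⟨q⟩ := hreach
  have hq : ∀ {u w : V} (q : (G.deleteEdges {s(x, y)}).Walk u w),
      s(x, y) ∈ (hT.rootPath r u).edges ↔ s(x, y) ∈ (hT.rootPath r w).edges := by
    intro u w q
    induction q with
    | nil => rfl
    | cons h _ ih => exact (hinv _ _ h).trans ih
  have := hT.mem_edges_rootPath_iff_not r (show T.Adj x y from heT)
  rw [hq q] at this
  tauto

-- For a tree edge, the two lower sets bounding its interval contribute `m` each. A non-tree edge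
-- occurs only in the sum of the piece containing it, which accounts for the `+ 1`.
open Finset in
theorem card_filter_mem_cycleSum_le [Fintype V] (enc : Sym2 V → ℕ)
    (henc : Function.Injective enc) (m : ℕ) (𝒮 : Finset (Finset (Sym2 V)))
    (h𝒮 : ∀ S ∈ 𝒮, ∀ f ∈ S, f ∉ T.edgeSet) (hdisj : (𝒮 : Set (Finset (Sym2 V))).PairwiseDisjoint id)
    (hU : ∀ U : Set (List ℕ), IsLowerSet U →
      #{S ∈ 𝒮 | crossParity (fun f => (hT.rootPath r (a f)).edges.map enc)
        (fun f => (hT.rootPath r (b f)).edges.map enc) U S = 1} ≤ m) (e : Sym2 V) :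
    #{S ∈ 𝒮 | e ∈ hT.cycleSum r a b S} ≤ 2 * m + 1 := by
  classical
  by_cases he : e ∈ T.edgeSet
  · obtain ⟨U₁, U₂, hU₁, hU₂, h21, hmem⟩ := hT.exists_lowerSets r enc henc he
    have hsum : ∀ S ∈ 𝒮, ∑ f ∈ S, hT.cycleVec r a b f e =
        crossParity (fun f => (hT.rootPath r (a f)).edges.map enc)
          (fun f => (hT.rootPath r (b f)).edges.map enc) U₁ S +
        crossParity (fun f => (hT.rootPath r (a f)).edges.map enc)
          (fun f => (hT.rootPath r (b f)).edges.map enc) U₂ S := by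
      intro S hS
      rw [crossParity, crossParity, ← sum_add_distrib]
      refine sum_congr rfl fun f hf => ?_
      have hind : ∀ v, (if e ∈ (hT.rootPath r v).edges then (1 : ZMod 2) else 0) =
          (if (hT.rootPath r v).edges.map enc ∈ U₁ then 1 else 0) +
          (if (hT.rootPath r v).edges.map enc ∈ U₂ then 1 else 0) := by
        intro v
        simp only [hmem v]
        by_cases h2 : (hT.rootPath r v).edges.map enc ∈ U₂
        · simp only [Set.mem_sdiff, h2, h21 h2]
          decide
        · simp [h2]
      rw [hT.cycleVec_of_mem r a b he (h𝒮 S hS f hf), hind, hind]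
      ring
    have hsub : ({S ∈ 𝒮 | e ∈ hT.cycleSum r a b S} : Finset _) ⊆
        {S ∈ 𝒮 | crossParity (fun f => (hT.rootPath r (a f)).edges.map enc)
          (fun f => (hT.rootPath r (b f)).edges.map enc) U₁ S = 1} ∪
        {S ∈ 𝒮 | crossParity (fun f => (hT.rootPath r (a f)).edges.map enc)
          (fun f => (hT.rootPath r (b f)).edges.map enc) U₂ S = 1} := by
      intro S hS
      obtain ⟨hS, heS⟩ := mem_filter.1 hS
      rw [mem_cycleSum, hsum S hS] at heS
      simp only [mem_union, mem_filter, hS, true_and]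
      revert heS
      generalize crossParity _ _ U₁ S = z₁
      generalize crossParity _ _ U₂ S = z₂
      revert z₁ z₂; decide
    have h1 := card_le_card hsub
    have h2 := hU U₁ hU₁
    have h3 := hU U₂ hU₂
    have h4 := card_union_le
      {S ∈ 𝒮 | crossParity (fun f => (hT.rootPath r (a f)).edges.map enc)
          (fun f => (hT.rootPath r (b f)).edges.map enc) U₁ S = 1}
      {S ∈ 𝒮 | crossParity (fun f => (hT.rootPath r (a f)).edges.map enc)
          (fun f => (hT.rootPath r (b f)).edges.map enc) U₂ S = 1}
    omega
  · have : #{S ∈ 𝒮 | e ∈ hT.cycleSum r a b S} ≤ 1 := by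
      rw [card_le_one]
      have hmem : ∀ S, e ∈ hT.cycleSum r a b S → e ∈ S := by
        intro S h
        rw [mem_cycleSum, hT.sum_cycleVec_of_notMem r a b he] at h
        by_contra hcon
        simp [hcon] at h
      intro S hS R hR
      by_contra hne
      obtain ⟨hS, heS⟩ := mem_filter.1 hS
      obtain ⟨hR, heR⟩ := mem_filter.1 hR
      have hSR : Disjoint S R := hdisj hS hR hne
      exact Finset.disjoint_left.1 hSR (hmem S heS) (hmem R heR)
    omega

end SimpleGraph.IsTree

/-! ### Assembly and constants -/

open Finset in
/-- A covering of all edges on cycles, with bounds in terms of `L` where `|V| < 2 ^ L`. -/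
theorem exists_cycleCover_of_lt_two_pow {V : Type*} [Fintype V] [DecidableEq V]
    {G T : SimpleGraph V} (r : V) (hTG : T ≤ G) (hT : T.IsTree) (L : ℕ)
    (hL : Fintype.card V < 2 ^ L) :
    ∃ 𝒞 : Finset (Finset (Sym2 V)), (∀ C ∈ 𝒞, IsCycleOf G C) ∧
      (∀ C ∈ 𝒞, #C ≤ (4 * L + 3) * (2 * treeDepth T r + 1)) ∧
      (∀ e ∈ cycleEdges G, ∃ C ∈ 𝒞, e ∈ C) ∧
      ∀ e, #{C ∈ 𝒞 | e ∈ C} ≤ 2 * L * (64 * L + 1) := by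
  classical
  have hab : ∀ f : Sym2 V, ∃ p : V × V, s(p.1, p.2) = f := fun f => by
    induction f with | _ x y => exact ⟨(x, y), rfl⟩
  choose p hp using hab
  set a : Sym2 V → V := fun f => (p f).1
  set b : Sym2 V → V := fun f => (p f).2
  let enc : Sym2 V → ℕ := fun e => Fintype.equivFin (Sym2 V) e
  have henc : Function.Injective enc := Fin.val_injective.comp (Fintype.equivFin _).injective
  -- Edge sets have size at most `n ^ 2`, which is why `2 * L` serves as the number of chosen
  -- subsets and as the recursion depth.
  have hcard : ∀ A : Finset (Sym2 V), #A < 2 ^ (2 * L) := by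
    intro A
    have h1 : Fintype.card (Sym2 V) ≤ Fintype.card V * Fintype.card V := by
      rw [← Fintype.card_prod]
      exact Fintype.card_le_of_injective p fun e f h => by rw [← hp e, ← hp f, h]
    calc #A ≤ Fintype.card (Sym2 V) := card_le_univ A
      _ ≤ Fintype.card V * Fintype.card V := h1
      _ < 2 ^ L * 2 ^ L := Nat.mul_self_lt_mul_self hL
      _ = 2 ^ (2 * L) := by rw [← pow_add, two_mul]
  let F : Finset (Sym2 V) := {f | f ∈ G.edgeSet \ T.edgeSet}
  have hFmem : ∀ f, f ∈ F ↔ f ∈ G.edgeSet \ T.edgeSet := fun f => by simp [F]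
  let Q : Finset (Sym2 V) := {e | e ∈ cycleEdges G}
  obtain ⟨ℱ, hℱ1, hℱ2, hℱ3⟩ := exists_family_sum_eq_one F (hT.cycleVec r a b) (2 * L) Q
    (fun e he => by
      obtain ⟨f, hf, h⟩ := hT.exists_cycleVec_eq_one r a b hp (mem_filter.1 he).2
      exact ⟨f, (hFmem f).2 hf, h⟩) (hcard Q)
  have hpart := fun F' : Finset (Sym2 V) => exists_partition_crossParity_le
    (fun f => (hT.rootPath r (a f)).edges.map enc)
    (fun f => (hT.rootPath r (b f)).edges.map enc) (2 * L) (2 * L) le_rfl F' (hcard F')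
  choose 𝒮 h𝒮1 h𝒮2 h𝒮3 h𝒮4 using hpart
  have hSF : ∀ F' ∈ ℱ, ∀ S ∈ 𝒮 F', ∀ f ∈ S, f ∈ G.edgeSet \ T.edgeSet :=
    fun F' hF' S hS f hf => (hFmem f).1 (hℱ2 F' hF' ((h𝒮1 F' S hS).1 hf))
  have hdec : ∀ S : Finset (Sym2 V), ∃ 𝒟 : Finset (Finset (Sym2 V)),
      (∀ f ∈ S, f ∈ G.edgeSet) → (∀ C ∈ 𝒟, IsCycleOf G C) ∧
      (∀ C ∈ 𝒟, C ⊆ hT.cycleSum r a b S) ∧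
      (∀ e ∈ hT.cycleSum r a b S, ∃ C ∈ 𝒟, e ∈ C) ∧ ∀ e, #{C ∈ 𝒟 | e ∈ C} ≤ 1 := by
    intro S
    by_cases hS : ∀ f ∈ S, f ∈ G.edgeSet
    · obtain ⟨𝒟, h⟩ := exists_disjoint_cycles_of_even G (hT.cycleSum r a b S)
        (hT.mem_edgeSet_of_mem_cycleSum r a b hTG hS)
        (hT.even_card_filter_cycleSum r a b hp fun f hf => G.not_isDiag_of_mem_edgeSet (hS f hf))
      exact ⟨𝒟, fun _ => h⟩
    · exact ⟨∅, fun h => absurd h hS⟩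
  choose 𝒟 h𝒟 using hdec
  have h𝒟' : ∀ F' ∈ ℱ, ∀ S ∈ 𝒮 F', _ := fun F' hF' S hS =>
    h𝒟 S fun f hf => (hSF F' hF' S hS f hf).1
  refine ⟨ℱ.biUnion fun F' => (𝒮 F').biUnion 𝒟, ?_, ?_, ?_, ?_⟩
  · intro C hC
    simp only [mem_biUnion] at hC
    obtain ⟨F', hF', S, hS, hC⟩ := hC
    exact (h𝒟' F' hF' S hS).1 C hC
  · intro C hC
    simp only [mem_biUnion] at hC
    obtain ⟨F', hF', S, hS, hC⟩ := hC
    calc #C ≤ #(hT.cycleSum r a b S) := card_le_card ((h𝒟' F' hF' S hS).2.1 C hC)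
      _ ≤ #S * (2 * treeDepth T r + 1) := hT.card_cycleSum_le r a b S
      _ ≤ (4 * L + 3) * (2 * treeDepth T r + 1) := by
        have := (h𝒮1 F' S hS).2
        exact Nat.mul_le_mul_right _ (by omega)
  · intro e he
    obtain ⟨F', hF', h⟩ := hℱ3 e (by simpa [Q] using he)
    obtain ⟨S, hS, hSe⟩ : ∃ S ∈ 𝒮 F', e ∈ hT.cycleSum r a b S := by
      by_contra! hno
      rw [← h𝒮3 F', sum_biUnion (h𝒮2 F'), sum_eq_zero fun S hS => ?_] at h
      · exact absurd h (by decide)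
      · have := hno S hS
        rw [hT.mem_cycleSum] at this
        simp only [id]
        revert this
        generalize ∑ f ∈ S, hT.cycleVec r a b f e = z
        revert z; decide
    obtain ⟨C, hC, heC⟩ := (h𝒟' F' hF' S hS).2.2.1 e hSe
    exact ⟨C, mem_biUnion.2 ⟨F', hF', mem_biUnion.2 ⟨S, hS, hC⟩⟩, heC⟩
  · intro e
    rw [filter_biUnion]
    refine (card_biUnion_le_card_mul ℱ _ (64 * L + 1) fun F' hF' => ?_).trans
      (Nat.mul_le_mul_right _ hℱ1)
    rw [filter_biUnion]
    have hsub : ((𝒮 F').biUnion fun S => {C ∈ 𝒟 S | e ∈ C}) ⊆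
        ({S ∈ 𝒮 F' | e ∈ hT.cycleSum r a b S} : Finset _).biUnion
          fun S => {C ∈ 𝒟 S | e ∈ C} := by
      intro C hC
      simp only [mem_biUnion, mem_filter] at hC ⊢
      obtain ⟨S, hS, hC, heC⟩ := hC
      exact ⟨S, ⟨hS, (h𝒟' F' hF' S hS).2.1 C hC heC⟩, hC, heC⟩
    have h1 := hT.card_filter_mem_cycleSum_le r a b enc henc (16 * (2 * L)) (𝒮 F')
      (fun S hS f hf => (hSF F' hF' S hS f hf).2) (h𝒮2 F') (h𝒮4 F') e
    have h2 := card_biUnion_le_card_mul ({S ∈ 𝒮 F' | e ∈ hT.cycleSum r a b S} : Finset _)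
      (fun S => {C ∈ 𝒟 S | e ∈ C}) 1 fun S hS =>
        (h𝒟' F' hF' S (mem_filter.1 hS).1).2.2.2 e
    have h3 := card_le_card hsub
    omega

theorem IsCycleOf.three_le_card {V : Type*} [Fintype V] [DecidableEq V] {G : SimpleGraph V}
    {C : Finset (Sym2 V)} (hC : IsCycleOf G C) : 3 ≤ Fintype.card V := by
  obtain ⟨v, p, hp, -⟩ := hC
  have h1 := hp.three_le_length
  have h2 := hp.support_nodup.length_le_card
  rw [List.length_tail, SimpleGraph.Walk.length_support] at h2
  omega

theorem exists_isCycleCover {V : Type*} [Fintype V] [DecidableEq V]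
    {G T : SimpleGraph V} (r : V) (hTG : T ≤ G) (hT : T.IsTree) :
    ∃ 𝒞 : Finset (Finset (Sym2 V)), IsCycleCover G (cycleEdges G)
      (1000 * (treeDepth T r * Real.log (Fintype.card V)))
      (1000 * Real.log (Fintype.card V) ^ 3) 𝒞 := by
  by_cases hn : Fintype.card V < 3
  · refine ⟨∅, by simp, by simp, ?_, ?_⟩
    · rintro e ⟨C, hC, -⟩
      exact absurd hC.three_le_card (by omega)
    · intro e _
      have : 0 ≤ Real.log (Fintype.card V) := Real.log_natCast_nonneg _
      simp only [Finset.filter_empty, Finset.card_empty, Nat.cast_zero]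
      positivity
  push Not at hn
  set n := Fintype.card V with hndef
  set x := Real.log n with hx
  -- From `n ≥ 3 > e`; this lets additive constants be absorbed into multiples of `x`.
  have hx1 : 1 ≤ x := by
    rw [hx, Real.le_log_iff_exp_le (by positivity)]
    calc Real.exp 1 ≤ 3 := by linarith [Real.exp_one_lt_d9]
      _ ≤ (n : ℝ) := by exact_mod_cast hn
  have hLx : ((Nat.log 2 n + 1 : ℕ) : ℝ) ≤ 2.5 * x := by
    have h1 : 2 ^ Nat.log 2 n ≤ n := Nat.pow_log_le_self 2 (by omega)
    have h2 : Real.log ((2 : ℝ) ^ Nat.log 2 n) ≤ x :=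
      Real.log_le_log (by positivity) (by exact_mod_cast h1)
    rw [Real.log_pow] at h2
    have h3 := Real.log_two_gt_d9
    have h4 : (0 : ℝ) ≤ (Nat.log 2 n : ℝ) := by positivity
    push_cast
    nlinarith
  obtain ⟨𝒞, h1, h2, h3, h4⟩ := exists_cycleCover_of_lt_two_pow (G := G) r hTG hT
    (Nat.log 2 n + 1) (Nat.lt_pow_succ_log_self (by norm_num) n)
  set L := Nat.log 2 n + 1 with hLdef
  have hL1 : (1 : ℝ) ≤ L := by exact_mod_cast (by omega : 1 ≤ L)
  -- Needed to absorb `2 * D + 1` into `3 * D`.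
  have hD : (1 : ℝ) ≤ treeDepth T r := by
    have : Nontrivial V := Fintype.one_lt_card_iff_nontrivial.1 (by omega)
    obtain ⟨v, hv⟩ := exists_ne r
    have h5 : 0 < T.dist r v := hT.1.pos_dist_of_ne hv.symm
    have h6 : T.dist r v ≤ treeDepth T r :=
      Finset.le_sup (f := fun v => T.dist r v) (Finset.mem_univ v)
    exact_mod_cast (by omega : 1 ≤ treeDepth T r)
  refine ⟨𝒞, h1, fun C hC => ?_, h3, fun e _ => ?_⟩
  · have h5 : (C.card : ℝ) ≤ (4 * L + 3) * (2 * treeDepth T r + 1) := by exact_mod_cast h2 C hC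
    calc (C.card : ℝ) ≤ (4 * L + 3) * (2 * treeDepth T r + 1) := h5
      _ ≤ (13 * x) * (3 * treeDepth T r) := by
        apply mul_le_mul <;> first | positivity | linarith
      _ ≤ 1000 * (treeDepth T r * x) := by nlinarith [mul_nonneg (zero_le_one.trans hD) (zero_le_one.trans hx1)]
  · have h5 : ((𝒞.filter fun C => e ∈ C).card : ℝ) ≤ 2 * L * (64 * L + 1) := by
      exact_mod_cast h4 e
    calc ((𝒞.filter fun C => e ∈ C).card : ℝ) ≤ 2 * L * (64 * L + 1) := h5
      _ ≤ (2 * (2.5 * x)) * (161 * x) := by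
        apply mul_le_mul <;> first | positivity | linarith
      -- The congestion is really quadratic in the logarithm; the third factor is slack, from `1 ≤
      -- x`.
      _ = 805 * x ^ 2 * 1 := by ring
      _ ≤ 1000 * x ^ 2 * x := by
        apply mul_le_mul <;> first | positivity | nlinarith
      _ = 1000 * x ^ 3 := by ring

theorem IsCycleCover.mono {V : Type*} [DecidableEq V] {G : SimpleGraph V} {E₁ E₂ : Set (Sym2 V)}
    {d₁ d₂ c : ℝ} {𝒞 : Finset (Finset (Sym2 V))} (h : IsCycleCover G E₁ d₁ c 𝒞) (hE : E₂ ⊆ E₁)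
    (hd : d₁ ≤ d₂) : IsCycleCover G E₂ d₂ c 𝒞 :=
  ⟨h.isCycle, fun C hC => (h.dilation C hC).trans hd, fun e he => h.covers e (hE he), h.congestion⟩

theorem Bridgeless.edgeSet_subset_cycleEdges {V : Type*} [DecidableEq V] {G : SimpleGraph V}
    (hG : Bridgeless G) : G.edgeSet ⊆ cycleEdges G := by
  intro e he
  induction e with | _ x y =>
  have hb : ¬ G.IsBridge s(x, y) := by
    rw [SimpleGraph.isBridge_iff]
    have := (hG.2 _ he) x y
    simpa [SimpleGraph.deleteEdges] using this
  rw [SimpleGraph.isBridge_iff_forall_cycle_notMem (by simpa using he)] at hb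
  push Not at hb
  obtain ⟨u, p, hp, hmem⟩ := hb
  exact ⟨_, ⟨u, p, hp, rfl⟩, by simpa using hmem⟩

/-- With one absolute constant `K`:
(1) for a bridgeless graph `G` and a rooted spanning tree `T` of depth `D`, the edges of `T` have
an `(O(D log n), O(log³ n))` cycle cover;
(2) if `G` is only connected, there is such a cover of all edges of `T` that lie on a cycle of `G`;
(3) hence every connected graph `G` of diameter `D` has an `(O(D log n), O(log³ n))` cycle cover
of all the edges that lie on a cycle of `G`. -/
theorem mainTheorem3 :
    ∃ K : ℝ, 0 < K ∧
      ∀ (V : Type*) [Fintype V] [DecidableEq V] (G : SimpleGraph V),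
        (Bridgeless G → ∀ (T : SimpleGraph V) (r : V), T ≤ G → T.IsTree →
          ∃ 𝒞 : Finset (Finset (Sym2 V)),
            IsCycleCover G T.edgeSet
              (K * (treeDepth T r * Real.log (Fintype.card V)))
              (K * Real.log (Fintype.card V) ^ 3) 𝒞) ∧
        (G.Connected → ∀ (T : SimpleGraph V) (r : V), T ≤ G → T.IsTree →
          ∃ 𝒞 : Finset (Finset (Sym2 V)),
            IsCycleCover G (T.edgeSet ∩ cycleEdges G)
              (K * (treeDepth T r * Real.log (Fintype.card V)))
              (K * Real.log (Fintype.card V) ^ 3) 𝒞) ∧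
        (G.Connected →
          ∃ 𝒞 : Finset (Finset (Sym2 V)),
            IsCycleCover G (cycleEdges G)
              (K * (G.diam * Real.log (Fintype.card V)))
              (K * Real.log (Fintype.card V) ^ 3) 𝒞) := by
  refine ⟨1000, by norm_num, fun V _ _ G => ⟨fun hG T r hTG hT => ?_, fun _ T r hTG hT => ?_,
    fun hG => ?_⟩⟩
  · obtain ⟨𝒞, h⟩ := exists_isCycleCover r hTG hT
    exact ⟨𝒞, h.mono ((SimpleGraph.edgeSet_mono hTG).trans hG.edgeSet_subset_cycleEdges) le_rfl⟩
  · obtain ⟨𝒞, h⟩ := exists_isCycleCover r hTG hT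
    exact ⟨𝒞, h.mono Set.inter_subset_right le_rfl⟩
  · obtain ⟨T, hTG, hT, r, hD⟩ := hG.exists_isTree_treeDepth_le
    obtain ⟨𝒞, h⟩ := exists_isCycleCover r hTG hT
    refine ⟨𝒞, h.mono subset_rfl ?_⟩
    have : 0 ≤ Real.log (Fintype.card V) := Real.log_natCast_nonneg _
    gcongr
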